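/- Let $E$ and $F$ be (real) Banach lattices, and let $E'$ be the norm dual of $E$ with its canonical order ($f\le g$ iff $f(x)\le g(x)$ for all $x\ge 0$ in $E$). A subset $A$ of a Banach space $X$ is called limited if it is norm bounded and every weak$^*$-null sequence in $X'$ converges to $0$ uniformly on $A$. A continuous linear operator $T:E\to F$ is called limited if it maps the closed unit ball of $E$ onto a limited subset of $F$, and Dunford--Pettis if it maps weakly null sequences in $E$ to norm null sequences in $F$. If every Dunford--Pettis operator $T:E\to F$ is limited, then either the norm of $E'$ is order continuous (that is, $\|x'_\alpha\|\to 0$ for every net $x'_\alpha\downarrow 0$ in $E'$), or every order bounded subset of $F$ is limited. -/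

import Mathlib

open Filter Topology

universe u

/-- The canonical order of the dual `X'` of an ordered normed space: `f ≤ g` iff `f x ≤ g x` for
all `x ≥ 0`. For a Banach lattice `E` this is the order that makes `E'` a Banach lattice. -/
instance dualPartialOrder (E : Type*) [NormedAddCommGroup E] [NormedSpace ℝ E] [Lattice E]
    [IsOrderedAddMonoid E] : PartialOrder (StrongDual ℝ E) where
  le f g := ∀ x : E, 0 ≤ x → f x ≤ g x
  le_refl _ _ _ := le_rfl
  le_trans _ _ _ hfg hgh x hx := (hfg x hx).trans (hgh x hx)
  le_antisymm f g hfg hgf := by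
    have key : ∀ x : E, 0 ≤ x → f x = g x := fun x hx => le_antisymm (hfg x hx) (hgf x hx)
    ext x
    rw [← posPart_sub_negPart x, map_sub, map_sub, key _ (posPart_nonneg x),
      key _ (negPart_nonneg x)]

/-- The norm of `V` is order continuous: every net decreasing to `0` (an antitone family indexed
by a nonempty directed set whose greatest lower bound is `0`) converges to `0` in norm.
Index sets from the universe of `V` suffice, since the range of a decreasing net is a
downward directed subset of `V`. -/
def HasOrderContinuousNorm (V : Type u) [NormedAddCommGroup V] [PartialOrder V] : Prop :=
  ∀ (ι : Type u) [Preorder ι] [IsDirectedOrder ι] [Nonempty ι] (x : ι → V),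
    Antitone x → IsGLB (Set.range x) 0 → Tendsto (fun i => ‖x i‖) atTop (𝓝 0)

/-- A sequence in `X` is weakly null. -/
def WeaklyNull {X : Type*} [NormedAddCommGroup X] [NormedSpace ℝ X] (x : ℕ → X) : Prop :=
  Tendsto (fun n => toWeakSpace ℝ X (x n)) atTop (𝓝 0)

/-- A sequence in the dual `X'` is weak-star null. -/
def WeakStarNull {X : Type*} [NormedAddCommGroup X] [NormedSpace ℝ X]
    (f : ℕ → StrongDual ℝ X) : Prop :=
  Tendsto (fun n => StrongDual.toWeakDual (f n)) atTop (𝓝 0)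

/-- A subset `A` of `X` is limited: it is norm bounded, and each weak-star null sequence in `X'`
converges to `0` uniformly on `A`. -/
def IsLimitedSet {X : Type*} [NormedAddCommGroup X] [NormedSpace ℝ X] (A : Set X) : Prop :=
  Bornology.IsBounded A ∧
    ∀ f : ℕ → StrongDual ℝ X, WeakStarNull f →
      TendstoUniformlyOn (fun n x => f n x) (fun _ => (0 : ℝ)) atTop A

/-- A continuous operator is limited: the image of the closed unit ball is a limited set. -/
def IsLimitedOperator {X Y : Type*} [NormedAddCommGroup X] [NormedSpace ℝ X]
    [NormedAddCommGroup Y] [NormedSpace ℝ Y] (T : X →L[ℝ] Y) : Prop :=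
  IsLimitedSet (T '' Metric.closedBall 0 1)

/-- A Dunford–Pettis (completely continuous) operator: it takes weakly null sequences to norm null
sequences. (A linear map with this property is automatically continuous.) -/
def IsDunfordPettisOperator {X Y : Type*} [NormedAddCommGroup X] [NormedSpace ℝ X]
    [NormedAddCommGroup Y] [NormedSpace ℝ Y] (T : X →L[ℝ] Y) : Prop :=
  ∀ x : ℕ → X, WeaklyNull x → Tendsto (fun n => T (x n)) atTop (𝓝 0)

/-- `A` is order bounded: it is contained in an order interval. -/
def IsOrderBounded {F : Type*} [Preorder F] (A : Set F) : Prop :=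
  ∃ a b : F, A ⊆ Set.Icc a b

/-! Argue by contraposition. If the norm of `E'` is not order continuous, differences along a
decreasing net give positive functionals `φ n`, bounded below in norm, with finite sums dominated by
one functional, so `x ↦ (φ n x)` maps `E` into `ℓ¹`. If an order bounded set is not limited, it
contains `y n` with `|f n (y n)| ≥ ε` for some weak-star null `f`. The operator `T x = ∑ φ n x • y
n` factors through `ℓ¹`, so it is Dunford–Pettis by Schur's lemma. After passing to a subsequence, a
gliding hump makes the diagonal terms dominate `f k (T (x k))`, where `x k` in the unit ball nearly
norms `φ k`; hence `T` is not limited. -/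

/-- Schur's lemma for real matrices: if the rows of `a` are absolutely summable and all signed row
sums tend to `0`, then the absolute row sums tend to `0`. -/
theorem tendsto_tsum_abs_of_tendsto_signed (a : ℕ → ℕ → ℝ) (ha : ∀ k, Summable fun n => |a k n|)
    (h : ∀ s : ℕ → Bool, Tendsto (fun k => ∑' n, (if s n then (1 : ℝ) else -1) * a k n) atTop (𝓝 0)) :
    Tendsto (fun k => ∑' n, |a k n|) atTop (𝓝 0) := by
  let σ : Bool → ℝ := fun b => if b then 1 else -1
  replace h : ∀ s : ℕ → Bool, Tendsto (fun k => ∑' n, σ (s n) * a k n) atTop (𝓝 0) := h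
  have hσ : ∀ b, |σ b| = 1 := by intro b; cases b <;> simp [σ]
  have hbd : ∀ k n (s : ℕ → Bool), ‖σ (s n) * a k n‖ ≤ |a k n| := by
    intro k n s; rw [Real.norm_eq_abs, abs_mul, hσ, one_mul]
  have hsum : ∀ k (s : ℕ → Bool), Summable fun n => σ (s n) * a k n := fun k s =>
    Summable.of_norm_bounded (ha k) fun n => hbd k n s
  have hcont : ∀ k, Continuous fun s : ℕ → Bool => ∑' n, σ (s n) * a k n := fun k =>
    continuous_tsum (fun n => ((continuous_of_discreteTopology (f := σ)).comp
      (continuous_apply n)).mul continuous_const) (ha k) (fun n s => hbd k n s)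
  have hentry : ∀ n, Tendsto (fun k => a k n) atTop (𝓝 0) := by
    intro n
    have h1 := h fun _ => true
    have h2 := h (Function.update (fun _ => true) n false)
    have h3 := (h1.sub h2).div_const 2
    rw [sub_zero, zero_div] at h3
    refine h3.congr fun k => ?_
    rw [← (hsum k _).tsum_sub (hsum k _), tsum_eq_single n]
    · simp [σ]
    · intro m hm; simp [σ, hm]
  rw [Metric.tendsto_atTop]
  intro ε hε
  -- Baire category on the compact space of sign patterns: some `K k₀` contains a cylinder, which
  -- fixes the signs on a finite set `I` and leaves the others free.
  let K : ℕ → Set (ℕ → Bool) := fun k₀ => {s | ∀ k ≥ k₀, |∑' n, σ (s n) * a k n| ≤ ε / 4}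
  have hKc : ∀ k₀, IsClosed (K k₀) := by
    intro k₀
    simp only [K, Set.ofPred_forall]
    exact isClosed_iInter fun k => isClosed_iInter fun _ =>
      isClosed_le (hcont k).abs continuous_const
  have hKU : ⋃ k₀, K k₀ = Set.univ := by
    refine Set.eq_univ_of_forall fun s => Set.mem_iUnion.2 ?_
    obtain ⟨k₀, hk₀⟩ := (Metric.tendsto_atTop.1 (h s)) (ε / 4) (by positivity)
    exact ⟨k₀, fun k hk => by
      have := (hk₀ k hk).le
      rwa [Real.dist_eq, sub_zero] at this⟩
  obtain ⟨k₀, s₀, hs₀⟩ := nonempty_interior_of_iUnion_of_closed hKc hKU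
  obtain ⟨I, u, hu, hIu⟩ := isOpen_pi_iff.1 isOpen_interior s₀ hs₀
  have hfin : Tendsto (fun k => ∑ n ∈ I, |a k n|) atTop (𝓝 0) := by
    simpa using tendsto_finsetSum I fun n _ => (hentry n).abs
  obtain ⟨k₁, hk₁⟩ := (Metric.tendsto_atTop.1 hfin) (ε / 4) (by positivity)
  refine ⟨max k₀ k₁, fun k hk => ?_⟩
  have hk1 := hk₁ k (le_of_max_le_right hk)
  rw [Real.dist_eq, sub_zero, abs_of_nonneg (Finset.sum_nonneg fun _ _ => abs_nonneg _)] at hk1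
  rw [Real.dist_eq, sub_zero, abs_of_nonneg (tsum_nonneg fun _ => abs_nonneg _)]
  classical
  -- Off `I` these are the signs of row `k`, so signed and absolute sums differ only on `I`, where
  -- the entries tend to `0`.
  let s : ℕ → Bool := fun n => if n ∈ I then s₀ n else decide (0 ≤ a k n)
  have hs : s ∈ K k₀ := interior_subset <| hIu fun n hn => by
    have hn' : n ∈ I := hn
    simpa [s, hn'] using (hu n hn').2
  have hval := hs k (le_of_max_le_left hk)
  have hdiff : ∑' n, |a k n| - ∑' n, σ (s n) * a k n = ∑ n ∈ I, (|a k n| - σ (s n) * a k n) := by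
    rw [← (ha k).tsum_sub (hsum k s)]
    refine tsum_eq_sum fun n hn => ?_
    by_cases h0 : 0 ≤ a k n
    · simp [s, hn, σ, h0, abs_of_nonneg h0]
    · simp [s, hn, σ, h0, abs_of_neg (not_le.1 h0)]
  have hle : ∑ n ∈ I, (|a k n| - σ (s n) * a k n) ≤ 2 * ∑ n ∈ I, |a k n| := by
    rw [Finset.mul_sum]
    refine Finset.sum_le_sum fun n _ => ?_
    have := (abs_le.1 (hbd k n s)).1
    linarith
  have := (abs_le.1 hval).2
  linarith

theorem tendsto_apply_of_weaklyNull {X : Type*} [NormedAddCommGroup X] [NormedSpace ℝ X]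
    {x : ℕ → X} (hx : WeaklyNull x) (g : StrongDual ℝ X) :
    Tendsto (fun k => g (x k)) atTop (𝓝 0) := by
  have h : Tendsto (fun k => g (x k)) atTop (𝓝 (g 0)) :=
    ((WeakBilin.eval_continuous (topDualPairing ℝ X).flip g).tendsto 0).comp hx
  rwa [map_zero] at h

theorem tendsto_apply_of_weakStarNull {X : Type*} [NormedAddCommGroup X] [NormedSpace ℝ X]
    {f : ℕ → StrongDual ℝ X} (hf : WeakStarNull f) (x : X) :
    Tendsto (fun k => f k x) atTop (𝓝 0) :=
  ((WeakDual.eval_continuous x).tendsto 0).comp hf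

/-- An operator that factors through `ℓ¹` is Dunford–Pettis. -/
theorem exists_dunfordPettis_tsum_smul {E F : Type*} [NormedAddCommGroup E] [NormedSpace ℝ E]
    [NormedAddCommGroup F] [NormedSpace ℝ F] [CompleteSpace F]
    (φ : ℕ → StrongDual ℝ E) (C M : ℝ) (hφ : ∀ x (s : Finset ℕ), ∑ n ∈ s, |φ n x| ≤ C * ‖x‖)
    (y : ℕ → F) (hy : ∀ n, ‖y n‖ ≤ M) :
    ∃ T : E →L[ℝ] F, IsDunfordPettisOperator T ∧ ∀ x, HasSum (fun n => φ n x • y n) (T x) := by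
  have hM : 0 ≤ M := (norm_nonneg _).trans (hy 0)
  have hs : ∀ x, Summable fun n => |φ n x| := fun x =>
    summable_of_sum_le (fun _ => abs_nonneg _) (hφ x)
  have htl : ∀ x, ∑' n, |φ n x| ≤ C * ‖x‖ := fun x => (hs x).tsum_le_of_sum_le (hφ x)
  have hb : ∀ x n, ‖φ n x • y n‖ ≤ |φ n x| * M := fun x n => by
    rw [norm_smul, Real.norm_eq_abs]
    exact mul_le_mul_of_nonneg_left (hy n) (abs_nonneg _)
  have hsy : ∀ x, Summable fun n => φ n x • y n := fun x =>
    Summable.of_norm_bounded ((hs x).mul_right M) (hb x)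
  have hnorm : ∀ x, ‖∑' n, φ n x • y n‖ ≤ (∑' n, |φ n x|) * M := fun x => by
    rw [← tsum_mul_right]
    exact tsum_of_norm_bounded ((hs x).mul_right M).hasSum (hb x)
  let T : E →ₗ[ℝ] F :=
    { toFun := fun x => ∑' n, φ n x • y n
      map_add' := fun x z => by
        rw [← (hsy x).tsum_add (hsy z)]; simp only [map_add, add_smul]
      map_smul' := fun c x => by
        simp only [map_smul, smul_eq_mul, mul_smul, RingHom.id_apply]
        exact (hsy x).tsum_const_smul c }
  refine ⟨T.mkContinuous (C * M) fun x => (hnorm x).trans ?_, fun x hx => ?_, fun x =>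
    (hsy x).hasSum⟩
  · calc _ ≤ C * ‖x‖ * M := mul_le_mul_of_nonneg_right (htl x) hM
      _ = _ := by ring
  · have hz : Tendsto (fun k => ∑' n, |φ n (x k)|) atTop (𝓝 0) := by
      refine tendsto_tsum_abs_of_tendsto_signed (fun k n => φ n (x k)) (fun k => hs _) fun s => ?_
      have hb' : ∀ z n, ‖(if s n then (1 : ℝ) else -1) * φ n z‖ ≤ |φ n z| := fun z n => by
        split_ifs <;> simp
      have hs' : ∀ z, Summable fun n => (if s n then (1 : ℝ) else -1) * φ n z := fun z =>
        Summable.of_norm_bounded (hs z) (hb' z)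
      -- Each signed sum is a bounded functional on `E`, so it tends to `0` along the weakly null
      -- sequence.
      let g : E →ₗ[ℝ] ℝ :=
        { toFun := fun z => ∑' n, (if s n then (1 : ℝ) else -1) * φ n z
          map_add' := fun z w => by
            rw [← (hs' z).tsum_add (hs' w)]; simp only [map_add, mul_add]
          map_smul' := fun c z => by
            simp only [map_smul, smul_eq_mul, RingHom.id_apply]
            rw [← tsum_mul_left]
            exact tsum_congr fun n => by ring }
      exact tendsto_apply_of_weaklyNull hx (g.mkContinuous C fun z =>
        (tsum_of_norm_bounded (hs z).hasSum (hb' z)).trans (htl z))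
    refine squeeze_zero_norm (fun k => hnorm (x k)) ?_
    simpa using hz.mul_const M

/-! ### Positive functionals and order intervals -/

/-- If the norm of the dual is not order continuous, there is a sequence of positive functionals,
bounded away from `0` in norm, whose finite sums are dominated by one functional. -/
theorem exists_dominated_sequence_of_not_hasOrderContinuousNorm {E : Type*}
    [NormedAddCommGroup E] [NormedSpace ℝ E] [Lattice E] [IsOrderedAddMonoid E]
    (h : ¬ HasOrderContinuousNorm (StrongDual ℝ E)) :
    ∃ (φ : ℕ → StrongDual ℝ E) (Φ : StrongDual ℝ E) (δ : ℝ), 0 < δ ∧ (∀ n, δ ≤ ‖φ n‖) ∧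
      (∀ n x, 0 ≤ x → 0 ≤ φ n x) ∧
      ∀ x, 0 ≤ x → ∀ s : Finset ℕ, ∑ n ∈ s, φ n x ≤ Φ x := by
  unfold HasOrderContinuousNorm at h
  push Not at h
  obtain ⟨ι, _, _, _, x, hx, hglb, hnt⟩ := h
  have hpos : ∀ i z, 0 ≤ z → 0 ≤ x i z := fun i z hz => hglb.1 (Set.mem_range_self i) z hz
  -- Otherwise the net is norm Cauchy, and its limit, being the infimum, is `0`.
  obtain ⟨δ, hδ, hstep⟩ : ∃ δ > 0, ∀ i, ∃ j ≥ i, δ ≤ ‖x i - x j‖ := by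
    by_contra! hcon
    apply hnt
    have hc : Cauchy (map x atTop) := by
      rw [Metric.cauchy_iff]
      refine ⟨inferInstance, fun ε hε => ?_⟩
      obtain ⟨i, hi⟩ := hcon (ε / 2) (by positivity)
      refine ⟨x '' Set.Ici i, image_mem_map (Ici_mem_atTop i), ?_⟩
      rintro _ ⟨j, hj, rfl⟩ _ ⟨k, hk, rfl⟩
      have h1 := hi j hj
      have h2 := hi k hk
      have h3 := dist_triangle_left (x j) (x k) (x i)
      rw [dist_eq_norm (x i), dist_eq_norm (x i)] at h3
      linarith
    obtain ⟨L, hL⟩ := CompleteSpace.complete hc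
    have hL : Tendsto x atTop (𝓝 L) := hL
    have hLz : ∀ z, Tendsto (fun i => x i z) atTop (𝓝 (L z)) := fun z =>
      ((ContinuousLinearMap.apply ℝ ℝ z).continuous.tendsto L).comp hL
    have hLglb : IsGLB (Set.range x) L := by
      constructor
      · rintro _ ⟨i, rfl⟩ z hz
        exact le_of_tendsto (hLz z) ((eventually_ge_atTop i).mono fun j hj => hx hj z hz)
      · intro b hb z hz
        exact ge_of_tendsto' (hLz z) fun i => hb (Set.mem_range_self i) z hz
    rw [hLglb.unique hglb] at hL
    simpa using hL.norm
  choose g hg hgδ using hstep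
  obtain ⟨i₀⟩ := ‹Nonempty ι›
  let α : ℕ → ι := fun n => g^[n] i₀
  have hα : ∀ n, α (n + 1) = g (α n) := fun n => Function.iterate_succ_apply' g n i₀
  have hφ : ∀ n z, 0 ≤ z → 0 ≤ (x (α n) - x (α (n + 1))) z := fun n z hz => by
    rw [hα, sub_apply, sub_nonneg]
    exact hx (hg (α n)) z hz
  refine ⟨fun n => x (α n) - x (α (n + 1)), x (α 0), δ, hδ, fun n => ?_, hφ, fun z hz s => ?_⟩
  · simpa only [hα] using hgδ (α n)
  · obtain ⟨N, hN⟩ := s.exists_nat_subset_range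
    calc _ ≤ ∑ n ∈ Finset.range N, (x (α n) - x (α (n + 1))) z :=
          Finset.sum_le_sum_of_subset_of_nonneg hN fun n _ _ => hφ n z hz
      _ = x (α 0) z - x (α N) z := by
          simp only [sub_apply]
          exact Finset.sum_range_sub' (fun n => x (α n) z) N
      _ ≤ _ := sub_le_self _ (hpos _ z hz)

theorem abs_apply_le_apply_abs {E : Type*} [NormedAddCommGroup E] [NormedSpace ℝ E] [Lattice E]
    [IsOrderedAddMonoid E] {g : StrongDual ℝ E} (hg : ∀ x, 0 ≤ x → 0 ≤ g x) (x : E) :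
    |g x| ≤ g |x| := by
  have h1 := hg _ (sub_nonneg.2 (le_abs_self x))
  have h2 := hg _ (sub_nonneg.2 (neg_le_abs x))
  simp only [map_sub, map_neg] at h1 h2
  exact abs_le.2 ⟨by linarith, by linarith⟩

/-- Passing from `x` to `|x|` keeps the norm and does not decrease `|g x|`; the factor `1 / 2` is
there because the norm need not be attained. -/
theorem exists_nonneg_half_norm_le_apply {E : Type*} [NormedAddCommGroup E] [NormedSpace ℝ E]
    [Lattice E] [IsOrderedAddMonoid E] [HasSolidNorm E] {g : StrongDual ℝ E}
    (hg : ∀ x, 0 ≤ x → 0 ≤ g x) {δ : ℝ} (hδ : 0 < δ) (hgδ : δ ≤ ‖g‖) :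
    ∃ x, 0 ≤ x ∧ ‖x‖ ≤ 1 ∧ δ / 2 ≤ g x := by
  by_contra! hcon
  have : ‖g‖ ≤ δ / 2 := by
    refine g.opNorm_le_of_unit_norm (by positivity) fun x hx => ?_
    exact (abs_apply_le_apply_abs hg x).trans
      (hcon |x| (abs_nonneg x) (by rw [norm_abs_eq_norm, hx])).le
  linarith

theorem IsOrderBounded.isBounded {F : Type*} [NormedAddCommGroup F] [Lattice F]
    [IsOrderedAddMonoid F] [HasSolidNorm F] {A : Set F} (hA : IsOrderBounded A) :
    Bornology.IsBounded A := by
  obtain ⟨a, b, hab⟩ := hA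
  refine (isBounded_iff_forall_norm_le).2 ⟨‖|a| + |b|‖, fun x hx => ?_⟩
  refine HasSolidNorm.solid ?_
  rw [abs_of_nonneg (add_nonneg (abs_nonneg a) (abs_nonneg b))]
  refine abs_le'.2 ⟨(hab hx).2.trans ((le_abs_self b).trans (le_add_of_nonneg_left (abs_nonneg a))),
    (neg_le_neg (hab hx).1).trans ((neg_le_abs a).trans (le_add_of_nonneg_right (abs_nonneg b)))⟩

/-! ### Subsequences and the gliding hump -/

theorem exists_strictMono_forall_lt_of_eventually {R : ℕ → ℕ → Prop}
    (h : ∀ i, ∀ᶠ j in atTop, R i j) :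
    ∃ ψ : ℕ → ℕ, StrictMono ψ ∧ ∀ i j, i < j → R (ψ i) (ψ j) := by
  choose N hN using fun i => eventually_atTop.1 (h i)
  let ψ : ℕ → ℕ := fun n => (fun i => max (i + 1) (N i))^[n] 0
  have hψ : ∀ n, ψ (n + 1) = max (ψ n + 1) (N (ψ n)) := fun n =>
    Function.iterate_succ_apply' _ n 0
  have hm : StrictMono ψ := strictMono_nat_of_lt_succ fun n => by rw [hψ]; omega
  refine ⟨ψ, hm, fun i j hij => hN _ _ ?_⟩
  have := hm.monotone (Nat.succ_le_of_lt hij)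
  rw [Nat.succ_eq_add_one, hψ] at this
  omega

theorem exists_weakStarNull_of_not_isLimitedSet {F : Type*} [NormedAddCommGroup F]
    [NormedSpace ℝ F] {A : Set F} (hA : Bornology.IsBounded A) (h : ¬ IsLimitedSet A) :
    ∃ (f : ℕ → StrongDual ℝ F) (y : ℕ → F) (ε : ℝ), 0 < ε ∧ WeakStarNull f ∧ (∀ n, y n ∈ A) ∧
      ∀ n, ε ≤ |f n (y n)| := by
  unfold IsLimitedSet at h
  push Not at h
  obtain ⟨f, hf, hu⟩ := h hA
  rw [Metric.tendstoUniformlyOn_iff] at hu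
  push Not at hu
  obtain ⟨ε, hε, hfr⟩ := hu
  obtain ⟨ψ, hψ, hψf⟩ := extraction_of_frequently_atTop hfr
  choose y hyA hy using hψf
  refine ⟨f ∘ ψ, y, ε, hε, hf.comp hψ.tendsto_atTop, hyA, fun n => ?_⟩
  simpa [Real.dist_eq] using hy n

theorem mainTheorem12
    {E F : Type*}
    [NormedAddCommGroup E] [NormedSpace ℝ E] [CompleteSpace E]
    [Lattice E] [IsOrderedAddMonoid E] [IsOrderedModule ℝ E] [HasSolidNorm E]
    [NormedAddCommGroup F] [NormedSpace ℝ F] [CompleteSpace F]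
    [Lattice F] [IsOrderedAddMonoid F] [IsOrderedModule ℝ F] [HasSolidNorm F]
    (h : ∀ T : E →L[ℝ] F, IsDunfordPettisOperator T → IsLimitedOperator T) :
    HasOrderContinuousNorm (StrongDual ℝ E) ∨
      ∀ A : Set F, IsOrderBounded A → IsLimitedSet A := by
  refine or_iff_not_imp_left.2 fun hE A hA => ?_
  by_contra hlim
  obtain ⟨φ, Φ, δ, hδ, hφδ, hφ0, hφΦ⟩ :=
    exists_dominated_sequence_of_not_hasOrderContinuousNorm hE
  obtain ⟨f, y, ε, hε, hf, hyA, hfy⟩ := exists_weakStarNull_of_not_isLimitedSet hA.isBounded hlim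
  obtain ⟨M, hM⟩ := isBounded_iff_forall_norm_le.1 hA.isBounded
  have hM0 : 0 ≤ M := (norm_nonneg _).trans (hM _ (hyA 0))
  choose x hx0 hx1 hxφ using fun n => exists_nonneg_half_norm_le_apply (hφ0 n) hδ (hφδ n)
  obtain ⟨B, hB⟩ : ∃ B, ∀ n, ‖f n‖ ≤ B := banach_steinhaus fun z => by
    obtain ⟨b, hb⟩ := (tendsto_apply_of_weakStarNull hf z).norm.bddAbove_range
    exact ⟨b, fun n => hb (Set.mem_range_self n)⟩
  have hB0 : 0 ≤ B := (norm_nonneg _).trans (hB 0)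
  have hfyB : ∀ i j, |f i (y j)| ≤ B * M := fun i j => by
    rw [← Real.norm_eq_abs]
    exact (f i).le_of_opNorm_le_of_le (hB i) (hM _ (hyA j))
  have hxΦ : ∀ k, Φ (x k) ≤ ‖Φ‖ := fun k =>
    (le_abs_self _).trans (by simpa using Φ.le_of_opNorm_le_of_le le_rfl (hx1 k))
  -- The small parameter controlling all entries off the diagonal.
  set D : ℝ := ‖Φ‖ + B * M + 1 with hD
  have hDpos : 0 < D := by positivity
  set η : ℝ := δ * ε / 4 / D with hη
  have hηpos : 0 < η := by positivity
  -- Later functionals `f j` are small at earlier `y i`, and tails of `φ` are small at earlier `x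
  -- i`.
  obtain ⟨ψ, hψ, hψR⟩ := exists_strictMono_forall_lt_of_eventually
    (R := fun i j => |f j (y i)| ≤ η ∧ ∀ s : Finset ℕ, (∀ n ∈ s, j ≤ n) →
      ∑ n ∈ s, φ n (x i) ≤ η) fun i => by
    refine Filter.Eventually.and ?_ ?_
    · have := (tendsto_apply_of_weakStarNull hf (y i)).abs
      rw [abs_zero] at this
      exact this.eventually_le_const hηpos
    · have hs : Summable fun n => φ n (x i) :=
        summable_of_sum_le (fun n => hφ0 n _ (hx0 i)) (hφΦ _ (hx0 i))
      obtain ⟨s₀, hs₀⟩ := summable_iff_vanishing_norm.1 hs η hηpos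
      obtain ⟨N, hN⟩ := s₀.exists_nat_subset_range
      filter_upwards [eventually_ge_atTop N] with j hj s hs
      refine (le_abs_self _).trans (hs₀ s (Finset.disjoint_left.2 fun n hn hn' => ?_)).le
      have h1 := hs n hn
      have h2 := Finset.mem_range.1 (hN hn')
      omega
  have hψΦ : ∀ z, 0 ≤ z → ∀ s : Finset ℕ, ∑ n ∈ s, φ (ψ n) z ≤ Φ z := fun z hz s => by
    simpa using hφΦ z hz (s.map ⟨ψ, hψ.injective⟩)
  obtain ⟨T, hTDP, hT⟩ := exists_dunfordPettis_tsum_smul (fun n => φ (ψ n)) ‖Φ‖ M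
    (fun z s => by
      calc ∑ n ∈ s, |φ (ψ n) z| ≤ ∑ n ∈ s, φ (ψ n) |z| :=
            Finset.sum_le_sum fun n _ => abs_apply_le_apply_abs (hφ0 _) z
        _ ≤ Φ |z| := hψΦ _ (abs_nonneg z) s
        _ ≤ ‖Φ‖ * ‖|z|‖ := (le_abs_self _).trans (Φ.le_opNorm _)
        _ = ‖Φ‖ * ‖z‖ := by rw [norm_abs_eq_norm])
    (fun n => y (ψ n)) (fun n => hM _ (hyA _))
  have hbig : ∀ k, δ * ε / 4 ≤ |f (ψ k) (T (x (ψ k)))| := by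
    intro k
    have hsum := ((f (ψ k)).hasSum (hT (x (ψ k))))
    simp only [map_smul, smul_eq_mul] at hsum
    refine ge_of_tendsto hsum.abs ((eventually_ge_atTop {k}).mono fun s hs => ?_)
    have hks : k ∈ s := hs (Finset.mem_singleton_self k)
    set v : ℕ → ℝ := fun j => φ (ψ j) (x (ψ k)) with hv
    have hv0 : ∀ j, 0 ≤ v j := fun j => hφ0 _ _ (hx0 _)
    have hdiag : δ / 2 * ε ≤ |v k * f (ψ k) (y (ψ k))| := by
      rw [abs_mul, abs_of_nonneg (hv0 k)]
      exact mul_le_mul (hxφ _) (hfy _) hε.le (hv0 k)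
    -- For `j < k` the factor `f (ψ k) (y (ψ j))` is at most `η` in absolute value and the `v j` sum
    -- to at most `‖Φ‖`; for `j > k` the `v j` sum to at most `η` and the other factor is at most `B
    -- * M`.
    have hlow : |∑ j ∈ s.erase k, v j * f (ψ k) (y (ψ j))| ≤ η * ‖Φ‖ + η * (B * M) := by
      have hterm : ∀ j ∈ s.erase k, |v j * f (ψ k) (y (ψ j))| ≤
          v j * η + if k < j then v j * (B * M) else 0 := by
        intro j hj
        rw [abs_mul, abs_of_nonneg (hv0 j)]
        rcases lt_or_gt_of_ne (Finset.ne_of_mem_erase hj) with hjk | hjk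
        · rw [if_neg hjk.not_gt, add_zero]
          exact mul_le_mul_of_nonneg_left (hψR j k hjk).1 (hv0 j)
        · rw [if_pos hjk]
          exact (mul_le_mul_of_nonneg_left (hfyB _ _) (hv0 j)).trans
            (le_add_of_nonneg_left (mul_nonneg (hv0 j) hηpos.le))
      refine (Finset.abs_sum_le_sum_abs _ _).trans ((Finset.sum_le_sum hterm).trans ?_)
      rw [Finset.sum_add_distrib, ← Finset.sum_mul, ← Finset.sum_filter, ← Finset.sum_mul,
        mul_comm η]
      refine add_le_add (mul_le_mul_of_nonneg_right ((hψΦ _ (hx0 _) _).trans (hxΦ _)) hηpos.le)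
        (mul_le_mul_of_nonneg_right ?_ (by positivity))
      have := (hψR k (k + 1) k.lt_succ_self).2
        (((s.erase k).filter (k < ·)).map ⟨ψ, hψ.injective⟩) (by
          intro n hn
          obtain ⟨j, hj, rfl⟩ := Finset.mem_map.1 hn
          exact hψ.monotone (Finset.mem_filter.1 hj).2)
      simpa using this
    have hηD : η * ‖Φ‖ + η * (B * M) ≤ δ * ε / 4 := by
      have : η * D = δ * ε / 4 := div_mul_cancel₀ _ hDpos.ne'
      rw [← this, hD]
      linarith
    rw [← Finset.add_sum_erase s _ hks]
    have := abs_sub_abs_le_abs_add (v k * f (ψ k) (y (ψ k)))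
      (∑ j ∈ s.erase k, v j * f (ψ k) (y (ψ j)))
    linarith
  have hTlim := Metric.tendstoUniformlyOn_iff.1 ((h T hTDP).2 f hf) (δ * ε / 4) (by positivity)
  obtain ⟨k, hk⟩ := (hψ.tendsto_atTop.eventually hTlim).exists
  have := hk (T (x (ψ k))) ⟨x (ψ k), by simpa using hx1 (ψ k), rfl⟩
  rw [Real.dist_eq, zero_sub, abs_neg] at this
  exact (hbig k).not_gt this
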